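/- Let $F$ be a field of characteristic $0$. Let $F\{\Omega;X\}$ be the free multioperator algebra on a set $X$ with a bilinear operation $[-,-]$, a trilinear operation $(-,-,-)$ and a quadrilinear operation $\langle -,-,-,-\rangle$; that is, the vector space with basis the formal monomials in these operations. In a (not necessarily associative or unital) $F$-algebra $A$, evaluate the elements of $F\{\Omega;X\}$ by interpreting the operations as the commutator $[a,b]=ab-ba$, the associator $(a,b,c)=(ab)c-a(bc)$ and the first quaternator $$\langle a,b,c,d\rangle=(ab,c,d)-a(b,c,d)-(a,c,d)b .$$ The algebra $A$ is power associative if every subalgebra generated by one element is associative. The element $f$ is satisfied by the commutator, associator and first quaternator of $A$ if it evaluates to $0$ under every assignment of elements of $A$ to its variables. The consequences of a set $\Gamma$ of such elements are the elements of the T-ideal generated by $\Gamma$: the smallest subspace that contains all substitution instances of elements of $\Gamma$ and contains the value of each of the three operations whenever one of its arguments lies in the subspace. The BTQ defining identities are \begin{align*} &[a,b]+[b,a]\equiv 0,\\ &(a,b,c)+(a,c,b)+(b,a,c)+(b,c,a)+(c,a,b)+(c,b,a)\equiv 0,\\ &[[a,b],c]+[[b,c],a]+[[c,a],b]-2(a,b,c)-2(b,c,a)-2(c,a,b)\equiv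 0,\\ &[(a,b,c),d]-[(d,b,c),a]-([a,d],b,c)+\langle a,d,b,c\rangle-\langle d,a,b,c\rangle\equiv 0,\\ &(a,[b,c],d)-(a,[b,d],c)+(a,[c,d],b)-(a,b,[c,d])+(a,c,[b,d])-(a,d,[b,c])\\ &\quad-\langle a,b,c,d\rangle+\langle a,b,d,c\rangle+\langle a,c,b,d\rangle-\langle a,c,d,b\rangle-\langle a,d,b,c\rangle+\langle a,d,c,b\rangle\equiv 0,\\ &[(a,b,c),d]-[(a,d,c),b]-[(c,b,a),d]+[(c,d,a),b]+[(b,a,d),c]-[(b,c,d),a]\\ &\quad-[(d,a,b),c]+[(d,c,b),a]-([a,b],c,d)-([a,d],b,c)-([c,b],d,a)-([c,d],a,b)\\ &\quad-(a,[c,b],d)-(c,[a,d],b)-(b,[c,d],a)-(d,[a,b],c)-(a,b,[c,d])-(c,d,[a,b])\\ &\quad-(b,c,[a,d])-(d,a,[c,b])\equiv 0,\\ &\sum_{\pi\in S_4}\langle x_{\pi(1)},x_{\pi(2)},x_{\pi(3)},x_{\pi(4)}\rangle\equiv 0, \end{align*} and the special identity of degree $5$ is $$[(a,[a,b],a),a]-[\langle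 a,a,a,b\rangle,a]+[\langle a,b,a,a\rangle,a]\equiv 0 .$$ Theorem. There exists $f\in F\{\Omega;\{a,b\}\}$, homogeneous of degree $3$ in $a$ and of degree $3$ in $b$ (hence of degree $6$), such that $f$ is satisfied by the commutator, associator and first quaternator in every power associative $F$-algebra, but $f$ is not a consequence of the BTQ defining identities together with the special identity of degree $5$. -/

import Mathlib

universe u v

/-- Nonassociative words over the variables `X` in one binary, one ternary and one quaternary
operation (BTQ monomials). -/
inductive BTQMonomial (X : Type) : Type
  | var (x : X) : BTQMonomial X
  | comm (s t : BTQMonomial X) : BTQMonomial X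
  | assoc (s t u : BTQMonomial X) : BTQMonomial X
  | quat (s t u v : BTQMonomial X) : BTQMonomial X

/-- The number of occurrences of the variable `x` in a BTQ monomial. -/
def BTQMonomial.degreeIn {X : Type} [DecidableEq X] (x : X) : BTQMonomial X → ℕ
  | .var y => if y = x then 1 else 0
  | .comm s t => s.degreeIn x + t.degreeIn x
  | .assoc s t u => s.degreeIn x + t.degreeIn x + u.degreeIn x
  | .quat s t u v => s.degreeIn x + t.degreeIn x + u.degreeIn x + v.degreeIn x

/-- The underlying vector space of the free multioperator algebra on `X` over `F` with one binary,
one ternary and one quaternary multilinear operation: the linear combinations of BTQ monomials. -/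
abbrev BTQPoly (F : Type*) [Field F] (X : Type) := BTQMonomial X →₀ F

/-- A binary, a ternary and a quaternary operation on `A`, used to evaluate BTQ polynomials.
The only two instances below are the free operations on `BTQPoly F X` and the commutator,
associator and first quaternator of a nonassociative algebra. -/
structure BTQOps (A : Type*) where
  comm : A → A → A
  assoc : A → A → A → A
  quat : A → A → A → A → A

/-- The value of a BTQ monomial in `A` at the assignment `v` of its variables. -/
def BTQMonomial.eval {A : Type*} {X : Type} (ω : BTQOps A) (v : X → A) : BTQMonomial X → A
  | .var x => v x
  | .comm s t => ω.comm (s.eval ω v) (t.eval ω v)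
  | .assoc s t u => ω.assoc (s.eval ω v) (t.eval ω v) (u.eval ω v)
  | .quat s t u w => ω.quat (s.eval ω v) (t.eval ω v) (u.eval ω v) (w.eval ω v)

namespace BTQPoly

/-- The value of a BTQ polynomial in `A` at the assignment `v` of its variables. -/
noncomputable def eval {F : Type*} [Field F] {A : Type*} [AddCommGroup A] [Module F A] {X : Type}
    (ω : BTQOps A) (v : X → A) (p : BTQPoly F X) : A :=
  p.sum fun m r => r • m.eval ω v

/-- A variable, as a BTQ polynomial. -/
noncomputable def var (F : Type*) [Field F] {X : Type} (x : X) : BTQPoly F X :=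
  Finsupp.single (.var x) 1

/-- The operations of the free multioperator algebra: the multilinear extensions of the formal
operations on monomials. -/
noncomputable def freeOps (F : Type*) [Field F] (X : Type) : BTQOps (BTQPoly F X) where
  comm p q := p.sum fun m r => q.sum fun n s => Finsupp.single (.comm m n) (r * s)
  assoc p q h := p.sum fun m r => q.sum fun n s => h.sum fun k t =>
    Finsupp.single (.assoc m n k) (r * s * t)
  quat p q h g := p.sum fun m r => q.sum fun n s => h.sum fun k t => g.sum fun l u =>
    Finsupp.single (.quat m n k l) (r * s * t * u)

/-- The consequences of a set `Γ` of identities: the T-ideal generated by `Γ`, that is, the least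
family of BTQ polynomials in the variables `Y` that contains all substitution instances of the
elements of `Γ`, is closed under linear combinations, and contains the value of each of the three
operations whenever one of its arguments is a consequence. -/
inductive IsConsequence {F : Type*} [Field F] {X Y : Type} (Γ : Set (BTQPoly F X)) :
    BTQPoly F Y → Prop
  | subst (p : BTQPoly F X) (hp : p ∈ Γ) (σ : X → BTQPoly F Y) :
      IsConsequence Γ (eval (freeOps F Y) σ p)
  | zero : IsConsequence Γ 0
  | add (p q : BTQPoly F Y) : IsConsequence Γ p → IsConsequence Γ q → IsConsequence Γ (p + q)
  | smul (r : F) (p : BTQPoly F Y) : IsConsequence Γ p → IsConsequence Γ (r • p)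
  | comm₁ (p a : BTQPoly F Y) : IsConsequence Γ p → IsConsequence Γ ((freeOps F Y).comm p a)
  | comm₂ (p a : BTQPoly F Y) : IsConsequence Γ p → IsConsequence Γ ((freeOps F Y).comm a p)
  | assoc₁ (p a b : BTQPoly F Y) :
      IsConsequence Γ p → IsConsequence Γ ((freeOps F Y).assoc p a b)
  | assoc₂ (p a b : BTQPoly F Y) :
      IsConsequence Γ p → IsConsequence Γ ((freeOps F Y).assoc a p b)
  | assoc₃ (p a b : BTQPoly F Y) :
      IsConsequence Γ p → IsConsequence Γ ((freeOps F Y).assoc a b p)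
  | quat₁ (p a b c : BTQPoly F Y) :
      IsConsequence Γ p → IsConsequence Γ ((freeOps F Y).quat p a b c)
  | quat₂ (p a b c : BTQPoly F Y) :
      IsConsequence Γ p → IsConsequence Γ ((freeOps F Y).quat a p b c)
  | quat₃ (p a b c : BTQPoly F Y) :
      IsConsequence Γ p → IsConsequence Γ ((freeOps F Y).quat a b p c)
  | quat₄ (p a b c : BTQPoly F Y) :
      IsConsequence Γ p → IsConsequence Γ ((freeOps F Y).quat a b c p)

end BTQPoly

namespace BTQOps

variable {A : Type*} [AddCommGroup A] (ω : BTQOps A)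

/-- The anticommutativity of the binary operation. -/
def anticomm (a b : A) : A :=
  ω.comm a b + ω.comm b a

/-- The vanishing of the symmetrized ternary operation. -/
def symmAssoc (a b c : A) : A :=
  ω.assoc a b c + ω.assoc a c b
    + ω.assoc b a c + ω.assoc b c a
    + ω.assoc c a b + ω.assoc c b a

/-- The cyclic sum of `[[a,b],c]` minus twice the cyclic sum of `(a,b,c)`. -/
def jacobiAssoc (a b c : A) : A :=
  ω.comm (ω.comm a b) c + ω.comm (ω.comm b c) a
    + ω.comm (ω.comm c a) b - 2 • ω.assoc a b c
    - 2 • ω.assoc b c a - 2 • ω.assoc c a b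

/-- First identity of degree 4: it expresses `⟨a,d,b,c⟩ - ⟨d,a,b,c⟩` by the other operations. -/
def quatSkew (a b c d : A) : A :=
  ω.comm (ω.assoc a b c) d - ω.comm (ω.assoc d b c) a
    - ω.assoc (ω.comm a d) b c + ω.quat a d b c
    - ω.quat d a b c

/-- Second identity of degree 4: the alternating sum of `⟨a,b,c,d⟩` over `b, c, d`. -/
def quatAlt (a b c d : A) : A :=
  ω.assoc a (ω.comm b c) d - ω.assoc a (ω.comm b d) c
    + ω.assoc a (ω.comm c d) b - ω.assoc a b (ω.comm c d)
    + ω.assoc a c (ω.comm b d) - ω.assoc a d (ω.comm b c)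
    - ω.quat a b c d + ω.quat a b d c
    + ω.quat a c b d - ω.quat a c d b
    - ω.quat a d b c + ω.quat a d c b

/-- Third identity of degree 4, involving only the binary and the ternary operation. -/
def akivis (a b c d : A) : A :=
  ω.comm (ω.assoc a b c) d - ω.comm (ω.assoc a d c) b
    - ω.comm (ω.assoc c b a) d + ω.comm (ω.assoc c d a) b
    + ω.comm (ω.assoc b a d) c - ω.comm (ω.assoc b c d) a
    - ω.comm (ω.assoc d a b) c + ω.comm (ω.assoc d c b) a
    - ω.assoc (ω.comm a b) c d - ω.assoc (ω.comm a d) b c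
    - ω.assoc (ω.comm c b) d a - ω.assoc (ω.comm c d) a b
    - ω.assoc a (ω.comm c b) d - ω.assoc c (ω.comm a d) b
    - ω.assoc b (ω.comm c d) a - ω.assoc d (ω.comm a b) c
    - ω.assoc a b (ω.comm c d) - ω.assoc c d (ω.comm a b)
    - ω.assoc b c (ω.comm a d) - ω.assoc d a (ω.comm c b)

/-- Fourth identity of degree 4: the sum of the quaternary operation over all permutations of its
arguments. -/
def symmQuat (x : Fin 4 → A) : A :=
  ∑ π : Equiv.Perm (Fin 4), ω.quat (x (π 0)) (x (π 1)) (x (π 2)) (x (π 3))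

/-- The special identity of degree 5,
`[(a,[a,b],a),a] - [⟨a,a,a,b⟩,a] + [⟨a,b,a,a⟩,a]`. -/
def special₅ (a b : A) : A :=
  ω.comm (ω.assoc a (ω.comm a b) a) a - ω.comm (ω.quat a a a b) a
    + ω.comm (ω.quat a b a a) a

end BTQOps

/-- The defining identities of BTQ algebras, in the four variables `x 0, x 1, x 2, x 3`. -/
def btqIdentities (F : Type*) [Field F] : Set (BTQPoly F (Fin 4)) :=
  let ω := BTQPoly.freeOps F (Fin 4)
  let x : Fin 4 → BTQPoly F (Fin 4) := BTQPoly.var F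
  {ω.anticomm (x 0) (x 1),
    ω.symmAssoc (x 0) (x 1) (x 2),
    ω.jacobiAssoc (x 0) (x 1) (x 2),
    ω.quatSkew (x 0) (x 1) (x 2) (x 3),
    ω.quatAlt (x 0) (x 1) (x 2) (x 3),
    ω.akivis (x 0) (x 1) (x 2) (x 3),
    ω.symmQuat x}

/-- The special identity of degree 5 as a BTQ polynomial in the variables `x 0, x 1`. -/
noncomputable def specialIdentity₅ (F : Type*) [Field F] : BTQPoly F (Fin 4) :=
  (BTQPoly.freeOps F (Fin 4)).special₅ (BTQPoly.var F 0) (BTQPoly.var F 1)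

/-- The commutator, the associator and the first quaternator
`⟨a,b,c,d⟩ = (ab,c,d) - a(b,c,d) - (a,c,d)b` of a nonassociative algebra. -/
def primitiveOps (A : Type*) [NonUnitalNonAssocRing A] : BTQOps A where
  comm a b := a * b - b * a
  assoc a b c := associator a b c
  quat a b c d := associator (a * b) c d - a * associator b c d - associator a c d * b

/-- A nonassociative algebra is power associative if each of its subalgebras generated by a single
element is associative. -/
def IsPowerAssociative (F A : Type*) [Field F] [NonUnitalNonAssocRing A] [Module F A]
    [IsScalarTower F A A] [SMulCommClass F A A] : Prop :=
  ∀ a : A, ∀ x ∈ NonUnitalAlgebra.adjoin F {a}, ∀ y ∈ NonUnitalAlgebra.adjoin F {a},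
    ∀ z ∈ NonUnitalAlgebra.adjoin F {a}, x * y * z = x * (y * z)

/-!
The identity of degree six is found in the language of the Jordan product `x ∘ y = xy + yx`
(`jmul`) and the commutator (`lmul`). In characteristic zero, power associativity amounts to the
linearizations of `(x, x, x) = 0`, which is `[x ∘ y, z] + [y ∘ z, x] + [z ∘ x, y] = 0`
(`cyclicComm`), and of `(x ∘ x) ∘ (x ∘ x) = ((x ∘ x) ∘ x) ∘ x` (`quartic`). Four derived
operations can be written in terms of the commutator, the associator and the first quaternator: the
associator of the Jordan product (`jassoc`), the defect of the Leibniz rule for the commutator and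
the Jordan product (`leibnizDefect`), and two quaternators of the Jordan product (`jquat`,
`jquatSymm`). For all but the first, the cyclic identity is needed. Substitutions of products of
`a`, `b` and `[b, a]` into the linearized identities, multiplied by further letters, have a linear
combination in which everything but values of these derived operations cancels
(`jordanSix_eq_zero`). Written in the three given operations, that combination is `special₆ a b`.

To see that it is not a consequence of the identities of lower degree, it suffices to have one
algebra with multilinear operations that satisfies them and in which `special₆ a b` does not vanish
(`IsConsequence.eval_eq_zero`). The four-dimensional algebra `testOps` does: its commutator is zero,
so the special identity of degree five is trivial in it, and the only terms of `special₆ a b` that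
survive are associators of `b`, `b` and `w`, with `w` a value of the quaternator on three `a` and
one `b`. The special identity of degree five says that certain elements of this kind commute with
`a` and does not constrain their associators with `b`; the new identity does.
-/

/-! ### Commutators and the Jordan product -/

section JordanLie

variable {A : Type*} [NonUnitalNonAssocRing A]

/-- The Jordan product, without the usual factor `1/2`. -/
def jmul (x y : A) : A := x * y + y * x

/-- The commutator. -/
def lmul (x y : A) : A := x * y - y * x

/-- The associator of the Jordan product. -/
def jassoc (x y z : A) : A := jmul (jmul x y) z - jmul x (jmul y z)

/-- The failure of the commutator with `z` to be a derivation of the Jordan product. -/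
def leibnizDefect (x y z : A) : A :=
  lmul (jmul x y) z - jmul x (lmul y z) - jmul y (lmul x z)

/-- The quaternator of the Jordan product with the product `x ∘ y` in the middle position. -/
def jquat (x y z w : A) : A :=
  jassoc z (jmul x y) w - jmul x (jassoc z y w) - jmul y (jassoc z x w)

/-- The quaternator of the Jordan product with the product `x ∘ y` in the first position, corrected
by products of two commutators. They cancel the products that the summand `[z, [x ∘ y, w]]` of
`(x ∘ y, z, w)⁺` leaves after expansion by the Leibniz rule, `(·, ·, ·)⁺` being `jassoc`. -/
def jquatLeft (x y z w : A) : A :=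
  jassoc (jmul x y) z w - jmul x (jassoc y z w) - jmul y (jassoc x z w)
    - jmul (lmul y w) (lmul z x) - jmul (lmul x w) (lmul z y)

/-- The symmetrization of `jquatLeft` over the symmetries of the pair of pairs `{x, y}`,
`{z, w}`. -/
def jquatSymm (x y z w : A) : A :=
  jquatLeft x y z w + jquatLeft x y w z + jquatLeft z w x y + jquatLeft z w y x

/-- The cyclic sum of `[x ∘ y, z]`, which is the full linearization of the associator
`(x, x, x)`. -/
def cyclicComm (x y z : A) : A := lmul (jmul x y) z + lmul (jmul y z) x + lmul (jmul z x) y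

/-- Up to a factor, the full linearization of `(x ∘ x) ∘ (x ∘ x) - ((x ∘ x) ∘ x) ∘ x`. -/
def quartic (x y z w : A) : A :=
  (4 : ℤ) • (jmul (jmul x y) (jmul z w) + jmul (jmul x z) (jmul y w) + jmul (jmul x w) (jmul y z))
    - (jmul (jmul (jmul x y) z) w + jmul (jmul (jmul x y) w) z
      + jmul (jmul (jmul z w) x) y + jmul (jmul (jmul z w) y) x
      + jmul (jmul (jmul x z) y) w + jmul (jmul (jmul x z) w) y
      + jmul (jmul (jmul y w) x) z + jmul (jmul (jmul y w) z) x
      + jmul (jmul (jmul x w) y) z + jmul (jmul (jmul x w) z) y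
      + jmul (jmul (jmul y z) x) w + jmul (jmul (jmul y z) w) x)

theorem jmul_comm (x y : A) : jmul x y = jmul y x := add_comm _ _

theorem zero_jmul (x : A) : jmul 0 x = 0 := by simp [jmul]

theorem zero_lmul (x : A) : lmul 0 x = 0 := by simp [lmul]

theorem jmul_add (x y z : A) : jmul x (y + z) = jmul x y + jmul x z := by
  simp only [jmul, mul_add, add_mul]; abel

theorem jmul_sub (x y z : A) : jmul x (y - z) = jmul x y - jmul x z := by
  simp only [jmul, mul_sub, sub_mul]; abel

theorem jmul_neg (x y : A) : jmul x (-y) = -jmul x y := by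
  simp only [jmul, mul_neg, neg_mul]; abel

theorem jmul_zsmul (n : ℤ) (x y : A) : jmul x (n • y) = n • jmul x y := by
  simp only [jmul, mul_smul_comm, smul_mul_assoc, smul_add]

theorem add_jmul (x y z : A) : jmul (y + z) x = jmul y x + jmul z x := by
  simp only [jmul_comm _ x, jmul_add]

theorem sub_jmul (x y z : A) : jmul (y - z) x = jmul y x - jmul z x := by
  simp only [jmul_comm _ x, jmul_sub]

theorem neg_jmul (x y : A) : jmul (-y) x = -jmul y x := by
  simp only [jmul_comm _ x, jmul_neg]

theorem zsmul_jmul (n : ℤ) (x y : A) : jmul (n • x) y = n • jmul x y := by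
  simp only [jmul_comm _ y, jmul_zsmul]

/-- A combination of values of the derived operations that vanishes in power associative algebras
for `c = [b, a]`. In the free nonassociative algebra it is a combination of substitution instances
of `cyclicComm` and `quartic`, with the coefficients that appear in the proof of
`jordanSix_eq_zero`; both lists were obtained by solving one system of linear equations. -/
def jordanSix (a b c : A) : A :=
  (9 : ℤ) • lmul c (jquatSymm b b a a)
  + (48 : ℤ) • lmul (jquat b c b a) a - (48 : ℤ) • lmul (jquat a c b a) b
  + (9 : ℤ) • jassoc b (jquatSymm b b a a) a
  - (24 : ℤ) • jassoc (jquat b b b a) a a + (24 : ℤ) • jassoc (jquat b a b a) b a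
  + (24 : ℤ) • jassoc (jquat b a b a) a b - (24 : ℤ) • jassoc (jquat a a b a) b b
  - (24 : ℤ) • leibnizDefect b b (jassoc a a c) + (48 : ℤ) • leibnizDefect b a (jassoc b a c)
  + (48 : ℤ) • leibnizDefect b c (jassoc b a a) - (24 : ℤ) • leibnizDefect a a (jassoc b b c)
  - (48 : ℤ) • leibnizDefect a c (jassoc b b a) + (96 : ℤ) • leibnizDefect (jassoc b c a) b a
  - (48 : ℤ) • leibnizDefect (jassoc b c a) a b
  - (72 : ℤ) • jquat c c b a
  - (48 : ℤ) • jquat (jassoc b b a) a b a + (48 : ℤ) • jquat (jassoc b a a) b b a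
  - (24 : ℤ) • jquatSymm (jassoc b b a) b a a - (24 : ℤ) • jquatSymm (jassoc b a a) a b b

set_option maxHeartbeats 4000000 in
theorem jordanSix_eq_zero (h3 : ∀ x y z : A, cyclicComm x y z = 0)
    (h4 : ∀ x y z w : A, quartic x y z w = 0) (a b : A) :
    jordanSix a b (lmul b a) = 0 := by
  obtain ⟨c, hc⟩ : ∃ c, lmul b a = c := ⟨_, rfl⟩
  rw [hc]
  have hba : b * a = a * b + c := by rw [← hc, lmul]; abel
  -- The left side expands into monomials in `jmul` and the product, with letters `a`, `b`, `c`;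
  -- ordering the factors of `jmul` makes equal monomials syntactically equal.
  have key : jordanSix a b c
    - (24 : ℤ) • cyclicComm (jmul b b) (jmul a a) c
    + (24 : ℤ) • cyclicComm (jmul b a) (jmul b a) c
    + (24 : ℤ) • cyclicComm c c c
    + (48 : ℤ) • cyclicComm (jmul (jmul b b) a) a c
    - (48 : ℤ) • cyclicComm (jmul (jmul b a) b) a c
    - (24 : ℤ) • cyclicComm (jmul (jmul b c) b) a a
    - (48 : ℤ) • cyclicComm (jmul (jmul b a) a) b c
    + (48 : ℤ) • cyclicComm (jmul (jmul a a) b) b c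
    + (48 : ℤ) • cyclicComm (jmul (jmul a c) b) b a
    - (24 : ℤ) • cyclicComm (jmul (jmul a c) a) b b
    - (2 : ℤ) • quartic (jmul (jmul b b) b) a a a
    - (6 : ℤ) • quartic (jmul (jmul b b) a) b a a
    + (12 : ℤ) • quartic (jmul (jmul b a) b) b a a
    - (12 : ℤ) • quartic (jmul (jmul b a) a) b b a
    + (6 : ℤ) • quartic (jmul (jmul a a) b) b b a
    + (2 : ℤ) • quartic (jmul (jmul a a) a) b b b
    + (120 : ℤ) • jmul (cyclicComm (jmul b b) a a) c
    - (240 : ℤ) • jmul (cyclicComm (jmul b a) b a) c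
    + (120 : ℤ) • jmul (cyclicComm (jmul a a) b b) c
    - (3 : ℤ) • lmul (quartic b b a a) c
    + (48 : ℤ) • jmul (cyclicComm (jmul b b) a c) a
    - (48 : ℤ) • jmul (cyclicComm (jmul b a) b c) a
    - (48 : ℤ) • jmul (cyclicComm (jmul b c) b a) a
    + (48 : ℤ) • jmul (cyclicComm (jmul a c) b b) a
    - (6 : ℤ) • jmul (quartic (jmul b b) b a a) a
    + (12 : ℤ) • jmul (quartic (jmul b a) b b a) a
    - (6 : ℤ) • jmul (quartic (jmul a a) b b b) a
    + (3 : ℤ) • jmul (jmul (quartic b b a a) b) a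
    - (48 : ℤ) • jmul (cyclicComm (jmul b a) a c) b
    + (48 : ℤ) • jmul (cyclicComm (jmul b c) a a) b
    + (48 : ℤ) • jmul (cyclicComm (jmul a a) b c) b
    - (48 : ℤ) • jmul (cyclicComm (jmul a c) b a) b
    + (6 : ℤ) • jmul (quartic (jmul b b) a a a) b
    - (12 : ℤ) • jmul (quartic (jmul b a) b a a) b
    + (6 : ℤ) • jmul (quartic (jmul a a) b b a) b
    - (3 : ℤ) • jmul (jmul (quartic b b a a) a) b = 0 := by
    simp only [jordanSix, cyclicComm, quartic, jquatSymm, jquatLeft, jquat, leibnizDefect, jassoc]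
    simp only [lmul, hba, sub_self, add_sub_cancel_left, sub_add_cancel_left]
    simp only [zero_jmul, jmul_add, jmul_sub, jmul_neg, add_jmul, sub_jmul, neg_jmul, zsmul_jmul,
      mul_add, add_mul, mul_sub, sub_mul, mul_neg, neg_mul, mul_smul_comm, smul_mul_assoc]
    simp only [jmul_comm]
    abel
  simpa only [h3, h4, zero_jmul, zero_lmul, smul_zero, add_zero, sub_zero] using key

end JordanLie

/-! ### The linearized identities of power associativity -/

section PowerAssociative

variable {A : Type*} [NonUnitalNonAssocRing A]

/-- Polarization of `(x, x, x) = 0`; no division is needed. -/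
theorem cyclicComm_eq_zero (h : ∀ x : A, associator x x x = 0) (x y z : A) :
    cyclicComm x y z = 0 := by
  have key : cyclicComm x y z = associator (x + y + z) (x + y + z) (x + y + z)
      - associator (x + y) (x + y) (x + y) - associator (y + z) (y + z) (y + z)
      - associator (x + z) (x + z) (x + z) + associator x x x + associator y y y
      + associator z z z := by
    simp only [cyclicComm, lmul, jmul, associator, mul_add, add_mul]
    abel
  simp only [key, h, sub_zero, add_zero]

/-- Polarization in two stages: from `x, x, x, x` to `x, x, y, y`, where the parts of odd degree in
`y` cancel between `x + y` and `x - y`, and then in each of the two pairs separately. -/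
theorem quartic_eq_zero (F : Type*) [Field F] [CharZero F] [Module F A]
    (h : ∀ x : A, quartic x x x x = 0) (x y z w : A) : quartic x y z w = 0 := by
  have torsion : ∀ (n : ℤ) (a : A), n ≠ 0 → n • a = 0 → a = 0 := fun n a hn ha => by
    rw [← Int.cast_smul_eq_zsmul F, smul_eq_zero] at ha
    exact ha.resolve_left (Int.cast_ne_zero.2 hn)
  have h₂ : ∀ x y : A, quartic x x y y = 0 := fun x y => by
    have key : (12 : ℤ) • quartic x x y y = quartic (x + y) (x + y) (x + y) (x + y)
        + quartic (x - y) (x - y) (x - y) (x - y) - (2 : ℤ) • quartic x x x x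
        - (2 : ℤ) • quartic y y y y := by
      simp only [quartic, jmul_add, add_jmul, jmul_sub, sub_jmul]
      simp only [jmul_comm]
      abel
    exact torsion 12 _ (by norm_num) (by simp only [key, h, smul_zero, add_zero, sub_zero])
  have h₃ : ∀ x y z : A, quartic x x y z = 0 := fun x y z => by
    have key : (2 : ℤ) • quartic x x y z = quartic x x (y + z) (y + z) - quartic x x y y
        - quartic x x z z := by
      simp only [quartic, jmul_add, add_jmul]
      simp only [jmul_comm]
      abel
    exact torsion 2 _ (by norm_num) (by simp only [key, h₂, sub_zero])
  have key : (2 : ℤ) • quartic x y z w = quartic (x + y) (x + y) z w - quartic x x z w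
      - quartic y y z w := by
    simp only [quartic, jmul_add, add_jmul]
    simp only [jmul_comm]
    abel
  exact torsion 2 _ (by norm_num) (by simp only [key, h₃, sub_zero])

variable {F : Type*} [Field F] [Module F A] [IsScalarTower F A A] [SMulCommClass F A A]

theorem IsPowerAssociative.associator_self (h : IsPowerAssociative F A) (x : A) :
    associator x x x = 0 := by
  have hx := NonUnitalAlgebra.self_mem_adjoin_singleton F x
  rw [associator, h x x hx x hx x hx, sub_self]

theorem IsPowerAssociative.quartic_self (h : IsPowerAssociative F A) (x : A) :
    quartic x x x x = 0 := by
  have hx := NonUnitalAlgebra.self_mem_adjoin_singleton F x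
  have hxx := mul_mem hx hx
  have e₃ : x * (x * x) = x * x * x := (h x x hx x hx x hx).symm
  have e₄ : x * x * x * x = x * x * (x * x) := h x _ hxx x hx x hx
  have e₅ : x * (x * x * x) = x * x * (x * x) := by
    rw [← h x x hx _ hxx x hx, e₃, e₄]
  simp only [quartic, jmul, mul_add, add_mul, e₃, e₄, e₅]
  abel

theorem IsPowerAssociative.jordanSix_eq_zero [CharZero F] (h : IsPowerAssociative F A) (a b : A) :
    jordanSix a b (lmul b a) = 0 :=
  _root_.jordanSix_eq_zero (cyclicComm_eq_zero h.associator_self)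
    (quartic_eq_zero F h.quartic_self) a b

end PowerAssociative

/-! ### Jordan operations in terms of the commutator, the associator and the quaternator -/

namespace BTQOps

variable {A : Type*} [AddCommGroup A] (ω : BTQOps A)

/-- The expression for the associator `jassoc` of the Jordan product, valid in all algebras. -/
def jordanAssoc (x y z : A) : A :=
  ω.assoc x y z - ω.assoc z y x + ω.assoc y x z - ω.assoc y z x - ω.assoc z x y + ω.assoc x z y
    + ω.comm y (ω.comm x z)

/-- The expression for `leibnizDefect`, valid in power associative algebras. -/
def derivDefect (x y z : A) : A :=
  (-2 : ℤ) • (ω.assoc x z y + ω.assoc y z x)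

/-- The expression for `jquat`, valid in power associative algebras. -/
def jordanQuat (x y z w : A) : A :=
  (2 : ℤ) • (ω.assoc x z (ω.comm y w)
    - ω.comm z (ω.assoc x y w) - ω.comm z (ω.assoc x w y)
    - ω.comm (ω.assoc x y z) w - ω.comm (ω.assoc x z y) w - ω.assoc x (ω.comm z y) w
    + ω.assoc x w (ω.comm z y) - ω.assoc x (ω.comm y w) z
    - ω.assoc y (ω.comm z x) w - ω.assoc y (ω.comm x w) z
    - ω.assoc z (ω.comm x w) y - ω.assoc w (ω.comm z x) y
    + (2 : ℤ) • ω.quat x z y w - (2 : ℤ) • ω.quat x w y z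
    + ω.quat y z x w - ω.quat y w x z + ω.quat z y x w - ω.quat w y x z)

/-- The expression for `jquatSymm`, valid in power associative algebras. -/
def jordanQuatSymm (x y z w : A) : A :=
  (4 : ℤ) • (ω.comm (ω.assoc x z y) w - ω.comm z (ω.assoc y w x)
    + ω.comm (ω.assoc z x w) y + ω.comm (ω.assoc w y z) x
    - ω.assoc x w (ω.comm z y) - ω.assoc y (ω.comm x w) z
    - ω.assoc z y (ω.comm x w) + ω.assoc (ω.comm z x) y w
    - ω.assoc (ω.comm z x) w y - ω.assoc (ω.comm z y) w x
    - ω.assoc w (ω.comm z y) x - ω.assoc (ω.comm x w) y z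
    - ω.assoc (ω.comm y w) x z + ω.assoc (ω.comm y w) z x
    + ω.quat x y z w + ω.quat x y w z + ω.quat y x z w + ω.quat y x w z
    + ω.quat z w x y + ω.quat z w y x + ω.quat w z x y + ω.quat w z y x)

/-- The expression for `jordanSix a b c`, valid in power associative algebras. -/
def sixAux (a b c : A) : A :=
  (9 : ℤ) • ω.comm c (ω.jordanQuatSymm b b a a)
  + (48 : ℤ) • ω.comm (ω.jordanQuat b c b a) a - (48 : ℤ) • ω.comm (ω.jordanQuat a c b a) b
  + (9 : ℤ) • ω.jordanAssoc b (ω.jordanQuatSymm b b a a) a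
  - (24 : ℤ) • ω.jordanAssoc (ω.jordanQuat b b b a) a a
  + (24 : ℤ) • ω.jordanAssoc (ω.jordanQuat b a b a) b a
  + (24 : ℤ) • ω.jordanAssoc (ω.jordanQuat b a b a) a b
  - (24 : ℤ) • ω.jordanAssoc (ω.jordanQuat a a b a) b b
  - (24 : ℤ) • ω.derivDefect b b (ω.jordanAssoc a a c)
  + (48 : ℤ) • ω.derivDefect b a (ω.jordanAssoc b a c)
  + (48 : ℤ) • ω.derivDefect b c (ω.jordanAssoc b a a)
  - (24 : ℤ) • ω.derivDefect a a (ω.jordanAssoc b b c)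
  - (48 : ℤ) • ω.derivDefect a c (ω.jordanAssoc b b a)
  + (96 : ℤ) • ω.derivDefect (ω.jordanAssoc b c a) b a
  - (48 : ℤ) • ω.derivDefect (ω.jordanAssoc b c a) a b
  - (72 : ℤ) • ω.jordanQuat c c b a
  - (48 : ℤ) • ω.jordanQuat (ω.jordanAssoc b b a) a b a
  + (48 : ℤ) • ω.jordanQuat (ω.jordanAssoc b a a) b b a
  - (24 : ℤ) • ω.jordanQuatSymm (ω.jordanAssoc b b a) b a a
  - (24 : ℤ) • ω.jordanQuatSymm (ω.jordanAssoc b a a) a b b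

/-- The special identity of degree six: `jordanSix a b [b, a]` in terms of the three operations. -/
def special₆ (a b : A) : A := ω.sixAux a b (ω.comm b a)

end BTQOps

section PrimitiveOps

variable {A : Type*} [NonUnitalNonAssocRing A]

theorem primitiveOps_comm (x y : A) : (primitiveOps A).comm x y = lmul x y := rfl

theorem primitiveOps_jordanAssoc (x y z : A) :
    (primitiveOps A).jordanAssoc x y z = jassoc x y z := by
  simp only [BTQOps.jordanAssoc, primitiveOps, jassoc, jmul, associator, mul_add, add_mul, mul_sub,
    sub_mul]
  abel

theorem primitiveOps_derivDefect (h : ∀ x y z : A, cyclicComm x y z = 0) (x y z : A) :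
    (primitiveOps A).derivDefect x y z = leibnizDefect x y z := by
  rw [← sub_eq_zero, ← neg_eq_zero, ← h x y z]
  simp only [BTQOps.derivDefect, primitiveOps, leibnizDefect, cyclicComm, jmul, lmul, associator,
    mul_add, add_mul, mul_sub, sub_mul]
  abel

theorem primitiveOps_jordanQuat (h : ∀ x y z : A, cyclicComm x y z = 0) (x y z w : A) :
    (primitiveOps A).jordanQuat x y z w = jquat x y z w := by
  have key : (primitiveOps A).jordanQuat x y z w - jquat x y z w
      + cyclicComm x (jmul y w) z - cyclicComm w x (jmul z y) + cyclicComm w y (lmul z x)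
      + cyclicComm (lmul x w) y z - jmul (cyclicComm x y z) w
      + jmul (cyclicComm w x y) z = 0 := by
    simp only [BTQOps.jordanQuat, primitiveOps, jquat, jassoc, cyclicComm, jmul, lmul, associator,
      mul_add, add_mul, mul_sub, sub_mul]
    abel
  simpa only [h, zero_jmul, add_zero, sub_zero, sub_eq_zero] using key

theorem primitiveOps_jordanQuatSymm (h : ∀ x y z : A, cyclicComm x y z = 0) (x y z w : A) :
    (primitiveOps A).jordanQuatSymm x y z w = jquatSymm x y z w := by
  have key : (primitiveOps A).jordanQuatSymm x y z w - jquatSymm x y z w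
      - cyclicComm x y (jmul z w) - cyclicComm x (jmul y w) z + cyclicComm w x (jmul z y)
      + (2 : ℤ) • cyclicComm w x (lmul z y) - cyclicComm w y (jmul z x)
      - cyclicComm w (jmul y x) z + cyclicComm (jmul x w) y z
      + (2 : ℤ) • cyclicComm (lmul x w) y z
      + jmul (cyclicComm x y z) w - lmul (cyclicComm x y z) w
      + jmul (cyclicComm w x y) z - lmul (cyclicComm w x y) z
      + jmul (cyclicComm w x z) y - lmul (cyclicComm w x z) y
      + jmul (cyclicComm w y z) x - lmul (cyclicComm w y z) x = 0 := by
    simp only [BTQOps.jordanQuatSymm, primitiveOps, jquatSymm, jquatLeft, jassoc, cyclicComm, jmul,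
      lmul, associator, mul_add, add_mul, mul_sub, sub_mul]
    abel
  simpa only [h, zero_jmul, zero_lmul, smul_zero, add_zero, sub_zero, sub_eq_zero] using key

variable {F : Type*} [Field F] [CharZero F] [Module F A] [IsScalarTower F A A] [SMulCommClass F A A]

theorem IsPowerAssociative.special₆_eq_zero (h : IsPowerAssociative F A) (a b : A) :
    (primitiveOps A).special₆ a b = 0 := by
  have h3 := cyclicComm_eq_zero h.associator_self
  simp only [BTQOps.special₆, BTQOps.sixAux, primitiveOps_comm, primitiveOps_jordanAssoc,
    primitiveOps_derivDefect h3, primitiveOps_jordanQuat h3, primitiveOps_jordanQuatSymm h3]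
  exact h.jordanSix_eq_zero a b

end PrimitiveOps

/-! ### Evaluation in multilinear models -/

/-- Each of the three operations is linear in each of its arguments. -/
structure BTQOps.IsMultilinear (F : Type*) [Field F] {A : Type*} [AddCommGroup A] [Module F A]
    (ω : BTQOps A) : Prop where
  comm₁ : ∀ y, IsLinearMap F fun x => ω.comm x y
  comm₂ : ∀ x, IsLinearMap F fun y => ω.comm x y
  assoc₁ : ∀ y z, IsLinearMap F fun x => ω.assoc x y z
  assoc₂ : ∀ x z, IsLinearMap F fun y => ω.assoc x y z
  assoc₃ : ∀ x y, IsLinearMap F fun z => ω.assoc x y z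
  quat₁ : ∀ y z w, IsLinearMap F fun x => ω.quat x y z w
  quat₂ : ∀ x z w, IsLinearMap F fun y => ω.quat x y z w
  quat₃ : ∀ x y w, IsLinearMap F fun z => ω.quat x y z w
  quat₄ : ∀ x y z, IsLinearMap F fun w => ω.quat x y z w

theorem primitiveOps_isMultilinear (F A : Type*) [Field F] [NonUnitalNonAssocRing A] [Module F A]
    [IsScalarTower F A A] [SMulCommClass F A A] : (primitiveOps A).IsMultilinear F := by
  constructor <;> intros <;> constructor <;> intros <;>
    simp only [primitiveOps, associator, mul_add, add_mul, mul_sub, sub_mul, mul_smul_comm,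
      smul_mul_assoc, smul_sub] <;>
    abel

theorem IsLinearMap.map_finsuppSum_smul {F ι A B : Type*} [Field F] [AddCommGroup A] [Module F A]
    [AddCommGroup B] [Module F B] {φ : A → B} (h : IsLinearMap F φ) (p : ι →₀ F) (g : ι → A) :
    φ (p.sum fun m r => r • g m) = p.sum fun m r => r • φ (g m) := by
  have := map_finsuppSum h.mk' p fun m r => r • g m
  simpa only [IsLinearMap.mk'_apply, h.map_smul] using this

namespace BTQPoly

variable {F : Type*} [Field F] {X Y : Type} {A : Type*} [AddCommGroup A] [Module F A]
  (ω : BTQOps A) (v : X → A)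

theorem eval_eq_linearCombination (p : BTQPoly F X) :
    eval ω v p = Finsupp.linearCombination F (fun m => m.eval ω v) p := rfl

theorem eval_add (p q : BTQPoly F X) : eval ω v (p + q) = eval ω v p + eval ω v q := by
  simp only [eval_eq_linearCombination, map_add]

theorem eval_sub (p q : BTQPoly F X) : eval ω v (p - q) = eval ω v p - eval ω v q := by
  simp only [eval_eq_linearCombination, map_sub]

theorem eval_smul (r : F) (p : BTQPoly F X) : eval ω v (r • p) = r • eval ω v p := by
  simp only [eval_eq_linearCombination, map_smul]

theorem eval_nsmul (n : ℕ) (p : BTQPoly F X) : eval ω v (n • p) = n • eval ω v p := by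
  simp only [eval_eq_linearCombination, map_nsmul]

theorem eval_zsmul (n : ℤ) (p : BTQPoly F X) : eval ω v (n • p) = n • eval ω v p := by
  simp only [eval_eq_linearCombination, map_zsmul]

theorem eval_zero : eval ω v (0 : BTQPoly F X) = 0 := by
  simp only [eval_eq_linearCombination, map_zero]

theorem eval_single (m : BTQMonomial X) (r : F) :
    eval ω v (Finsupp.single m r) = r • m.eval ω v := by
  simp only [eval_eq_linearCombination, Finsupp.linearCombination_single]

theorem eval_finsuppSum {ι : Type*} (p : ι →₀ F) (g : ι → F → BTQPoly F X) :
    eval ω v (p.sum g) = p.sum fun m r => eval ω v (g m r) := by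
  simp only [eval_eq_linearCombination, map_finsuppSum]

theorem eval_var (x : X) : eval ω v (var F x) = v x := by
  rw [var, eval_single, one_smul, BTQMonomial.eval]

theorem eval_sum {ι : Type*} (s : Finset ι) (g : ι → BTQPoly F X) :
    eval ω v (∑ i ∈ s, g i) = ∑ i ∈ s, eval ω v (g i) := by
  simp only [eval_eq_linearCombination, map_sum]

variable {ω} (hω : ω.IsMultilinear F)
include hω

theorem eval_comm (p q : BTQPoly F X) :
    eval ω v ((freeOps F X).comm p q) = ω.comm (eval ω v p) (eval ω v q) := by
  rw [eval.eq_def ω v p, (hω.comm₁ _).map_finsuppSum_smul, eval.eq_def ω v q]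
  simp only [freeOps, eval_finsuppSum, eval_single, BTQMonomial.eval,
    (hω.comm₂ _).map_finsuppSum_smul, Finsupp.smul_sum, smul_smul]

theorem eval_assoc (p q h : BTQPoly F X) :
    eval ω v ((freeOps F X).assoc p q h) = ω.assoc (eval ω v p) (eval ω v q) (eval ω v h) := by
  rw [eval.eq_def ω v p, (hω.assoc₁ _ _).map_finsuppSum_smul, eval.eq_def ω v q,
    eval.eq_def ω v h]
  simp only [freeOps, eval_finsuppSum, eval_single, BTQMonomial.eval,
    (hω.assoc₂ _ _).map_finsuppSum_smul, (hω.assoc₃ _ _).map_finsuppSum_smul, Finsupp.smul_sum,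
    smul_smul, mul_assoc]

theorem eval_quat (p q h g : BTQPoly F X) :
    eval ω v ((freeOps F X).quat p q h g) =
      ω.quat (eval ω v p) (eval ω v q) (eval ω v h) (eval ω v g) := by
  rw [eval.eq_def ω v p, (hω.quat₁ _ _ _).map_finsuppSum_smul, eval.eq_def ω v q,
    eval.eq_def ω v h, eval.eq_def ω v g]
  simp only [freeOps, eval_finsuppSum, eval_single, BTQMonomial.eval,
    (hω.quat₂ _ _ _).map_finsuppSum_smul, (hω.quat₃ _ _ _).map_finsuppSum_smul,
    (hω.quat₄ _ _ _).map_finsuppSum_smul, Finsupp.smul_sum, smul_smul, mul_assoc]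

theorem eval_monomial_eval (w : Y → A) (σ : X → BTQPoly F Y) (m : BTQMonomial X) :
    eval ω w (m.eval (freeOps F Y) σ) = m.eval ω fun x => eval ω w (σ x) := by
  induction m with
  | var x => rfl
  | comm s t hs ht => simp only [BTQMonomial.eval, eval_comm w hω, hs, ht]
  | assoc s t u hs ht hu => simp only [BTQMonomial.eval, eval_assoc w hω, hs, ht, hu]
  | quat s t u z hs ht hu hz => simp only [BTQMonomial.eval, eval_quat w hω, hs, ht, hu, hz]

theorem eval_eval (w : Y → A) (σ : X → BTQPoly F Y) (p : BTQPoly F X) :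
    eval ω w (eval (freeOps F Y) σ p) = eval ω (fun x => eval ω w (σ x)) p := by
  rw [eval.eq_def _ σ p, eval_finsuppSum]
  simp only [eval_smul, eval_monomial_eval hω]
  rfl

/-- The consequences of identities that hold in a model hold in the model. -/
theorem IsConsequence.eval_eq_zero {Γ : Set (BTQPoly F X)}
    (hΓ : ∀ p ∈ Γ, ∀ v : X → A, eval ω v p = 0) {p : BTQPoly F Y} (hp : IsConsequence Γ p)
    (w : Y → A) : eval ω w p = 0 := by
  induction hp with
  | subst p hp σ => rw [eval_eval hω, hΓ p hp]
  | zero => exact eval_zero ω w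
  | add p q _ _ hp hq => rw [eval_add, hp, hq, add_zero]
  | smul r p _ hp => rw [eval_smul, hp, smul_zero]
  | comm₁ p a _ hp => rw [eval_comm w hω, hp]; exact (hω.comm₁ _).map_zero
  | comm₂ p a _ hp => rw [eval_comm w hω, hp]; exact (hω.comm₂ _).map_zero
  | assoc₁ p a b _ hp => rw [eval_assoc w hω, hp]; exact (hω.assoc₁ _ _).map_zero
  | assoc₂ p a b _ hp => rw [eval_assoc w hω, hp]; exact (hω.assoc₂ _ _).map_zero
  | assoc₃ p a b _ hp => rw [eval_assoc w hω, hp]; exact (hω.assoc₃ _ _).map_zero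
  | quat₁ p a b c _ hp => rw [eval_quat w hω, hp]; exact (hω.quat₁ _ _ _).map_zero
  | quat₂ p a b c _ hp => rw [eval_quat w hω, hp]; exact (hω.quat₂ _ _ _).map_zero
  | quat₃ p a b c _ hp => rw [eval_quat w hω, hp]; exact (hω.quat₃ _ _ _).map_zero
  | quat₄ p a b c _ hp => rw [eval_quat w hω, hp]; exact (hω.quat₄ _ _ _).map_zero

theorem eval_special₆ (p q : BTQPoly F X) :
    eval ω v ((freeOps F X).special₆ p q) = ω.special₆ (eval ω v p) (eval ω v q) := by
  simp only [BTQOps.special₆, BTQOps.sixAux, BTQOps.jordanAssoc, BTQOps.derivDefect,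
    BTQOps.jordanQuat, BTQOps.jordanQuatSymm, eval_add, eval_sub, eval_zsmul, eval_comm v hω,
    eval_assoc v hω, eval_quat v hω]

/-- To satisfy the given identities as polynomials, a model only has to satisfy them as equations
between its own operations. -/
theorem eval_btqIdentities
    (anticomm : ∀ a b, ω.anticomm a b = 0) (symmAssoc : ∀ a b c, ω.symmAssoc a b c = 0)
    (jacobiAssoc : ∀ a b c, ω.jacobiAssoc a b c = 0)
    (quatSkew : ∀ a b c d, ω.quatSkew a b c d = 0) (quatAlt : ∀ a b c d, ω.quatAlt a b c d = 0)
    (akivis : ∀ a b c d, ω.akivis a b c d = 0) (symmQuat : ∀ x, ω.symmQuat x = 0)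
    (special₅ : ∀ a b, ω.special₅ a b = 0)
    (p : BTQPoly F (Fin 4)) (hp : p ∈ insert (specialIdentity₅ F) (btqIdentities F))
    (w : Fin 4 → A) : eval ω w p = 0 := by
  simp only [btqIdentities, specialIdentity₅, Set.mem_insert_iff, Set.mem_singleton_iff] at hp
  rcases hp with rfl | rfl | rfl | rfl | rfl | rfl | rfl | rfl
  · rw [← special₅ (w 0) (w 1)]
    simp only [BTQOps.special₅, eval_add, eval_sub, eval_comm w hω, eval_assoc w hω,
      eval_quat w hω, eval_var]
  · rw [← anticomm (w 0) (w 1)]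
    simp only [BTQOps.anticomm, eval_add, eval_comm w hω, eval_var]
  · rw [← symmAssoc (w 0) (w 1) (w 2)]
    simp only [BTQOps.symmAssoc, eval_add, eval_assoc w hω, eval_var]
  · rw [← jacobiAssoc (w 0) (w 1) (w 2)]
    simp only [BTQOps.jacobiAssoc, eval_add, eval_sub, eval_nsmul, eval_comm w hω,
      eval_assoc w hω, eval_var]
  · rw [← quatSkew (w 0) (w 1) (w 2) (w 3)]
    simp only [BTQOps.quatSkew, eval_add, eval_sub, eval_comm w hω, eval_assoc w hω,
      eval_quat w hω, eval_var]
  · rw [← quatAlt (w 0) (w 1) (w 2) (w 3)]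
    simp only [BTQOps.quatAlt, eval_add, eval_sub, eval_comm w hω, eval_assoc w hω,
      eval_quat w hω, eval_var]
  · rw [← akivis (w 0) (w 1) (w 2) (w 3)]
    simp only [BTQOps.akivis, eval_add, eval_sub, eval_comm w hω, eval_assoc w hω, eval_var]
  · rw [← symmQuat w]
    simp only [BTQOps.symmQuat, eval_sum, eval_quat w hω, eval_var]

end BTQPoly

/-! ### Homogeneity -/

namespace BTQPoly

/-- The BTQ polynomials in two variables that are homogeneous of bidegree `d`. -/
def homogeneous (F : Type*) [Field F] (d : ℕ × ℕ) : Submodule F (BTQPoly F (Fin 2)) :=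
  Finsupp.supported F F {m | (m.degreeIn 0, m.degreeIn 1) = d}

variable {F : Type*} [Field F] {d e k l g : ℕ × ℕ} {p q r s : BTQPoly F (Fin 2)}

theorem single_mem_homogeneous {m : BTQMonomial (Fin 2)} {c : F}
    (h : (m.degreeIn 0, m.degreeIn 1) = d) : Finsupp.single m c ∈ homogeneous F d :=
  Finsupp.single_mem_supported F c h

theorem comm_mem_homogeneous (hp : p ∈ homogeneous F d) (hq : q ∈ homogeneous F e)
    (hg : d + e = g) : (freeOps F (Fin 2)).comm p q ∈ homogeneous F g := by
  refine Submodule.sum_mem _ fun m hm => Submodule.sum_mem _ fun n hn => ?_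
  refine single_mem_homogeneous ?_
  rw [← hg, ← hp hm, ← hq hn]
  rfl

theorem assoc_mem_homogeneous (hp : p ∈ homogeneous F d) (hq : q ∈ homogeneous F e)
    (hr : r ∈ homogeneous F k) (hg : d + e + k = g) :
    (freeOps F (Fin 2)).assoc p q r ∈ homogeneous F g := by
  refine Submodule.sum_mem _ fun m hm => Submodule.sum_mem _ fun n hn =>
    Submodule.sum_mem _ fun o ho => ?_
  refine single_mem_homogeneous ?_
  rw [← hg, ← hp hm, ← hq hn, ← hr ho]
  rfl

theorem quat_mem_homogeneous (hp : p ∈ homogeneous F d) (hq : q ∈ homogeneous F e)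
    (hr : r ∈ homogeneous F k) (hs : s ∈ homogeneous F l) (hg : d + e + k + l = g) :
    (freeOps F (Fin 2)).quat p q r s ∈ homogeneous F g := by
  refine Submodule.sum_mem _ fun m hm => Submodule.sum_mem _ fun n hn =>
    Submodule.sum_mem _ fun o ho => Submodule.sum_mem _ fun t ht => ?_
  refine single_mem_homogeneous ?_
  rw [← hg, ← hp hm, ← hq hn, ← hr ho, ← hs ht]
  rfl

theorem zsmul_mem_homogeneous (n : ℤ) (hp : p ∈ homogeneous F d) : n • p ∈ homogeneous F d :=
  zsmul_mem hp n

theorem jordanAssoc_mem_homogeneous (hp : p ∈ homogeneous F d) (hq : q ∈ homogeneous F e)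
    (hr : r ∈ homogeneous F k) (hg : d + e + k = g) :
    (freeOps F (Fin 2)).jordanAssoc p q r ∈ homogeneous F g := by
  subst hg
  unfold BTQOps.jordanAssoc
  -- The bidegrees of inner terms are metavariables that `rfl` assigns. Reducible transparency keeps
  -- unification from unfolding the free operations into sums.
  repeat' first
    | with_reducible first
      | assumption | apply zsmul_mem_homogeneous | apply add_mem | apply sub_mem
      | apply comm_mem_homogeneous | apply assoc_mem_homogeneous
    | rfl | abel

theorem derivDefect_mem_homogeneous (hp : p ∈ homogeneous F d) (hq : q ∈ homogeneous F e)
    (hr : r ∈ homogeneous F k) (hg : d + e + k = g) :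
    (freeOps F (Fin 2)).derivDefect p q r ∈ homogeneous F g := by
  subst hg
  unfold BTQOps.derivDefect
  repeat' first
    | with_reducible first
      | assumption | apply zsmul_mem_homogeneous | apply add_mem | apply assoc_mem_homogeneous
    | rfl | abel

theorem jordanQuat_mem_homogeneous (hp : p ∈ homogeneous F d) (hq : q ∈ homogeneous F e)
    (hr : r ∈ homogeneous F k) (hs : s ∈ homogeneous F l) (hg : d + e + k + l = g) :
    (freeOps F (Fin 2)).jordanQuat p q r s ∈ homogeneous F g := by
  subst hg
  unfold BTQOps.jordanQuat
  repeat' first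
    | with_reducible first
      | assumption | apply zsmul_mem_homogeneous | apply add_mem | apply sub_mem
      | apply comm_mem_homogeneous | apply assoc_mem_homogeneous | apply quat_mem_homogeneous
    | rfl | abel

theorem jordanQuatSymm_mem_homogeneous (hp : p ∈ homogeneous F d) (hq : q ∈ homogeneous F e)
    (hr : r ∈ homogeneous F k) (hs : s ∈ homogeneous F l) (hg : d + e + k + l = g) :
    (freeOps F (Fin 2)).jordanQuatSymm p q r s ∈ homogeneous F g := by
  subst hg
  unfold BTQOps.jordanQuatSymm
  repeat' first
    | with_reducible first
      | assumption | apply zsmul_mem_homogeneous | apply add_mem | apply sub_mem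
      | apply comm_mem_homogeneous | apply assoc_mem_homogeneous | apply quat_mem_homogeneous
    | rfl | abel

theorem special₆_mem_homogeneous (hp : p ∈ homogeneous F (1, 0)) (hq : q ∈ homogeneous F (0, 1)) :
    (freeOps F (Fin 2)).special₆ p q ∈ homogeneous F (3, 3) := by
  unfold BTQOps.special₆ BTQOps.sixAux
  repeat' first
    | with_reducible first
      | assumption | apply zsmul_mem_homogeneous | apply add_mem | apply sub_mem
      | apply jordanAssoc_mem_homogeneous | apply derivDefect_mem_homogeneous
      | apply jordanQuat_mem_homogeneous | apply jordanQuatSymm_mem_homogeneous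
      | apply comm_mem_homogeneous
    | rfl

end BTQPoly

/-! ### A four-dimensional model -/

/-- The operations on `F⁴` with basis `a, b, c, z` whose only nonzero values on basis elements are
`⟨a,a,b,a⟩ = c`, `⟨a,a,a,b⟩ = -c`, `(b,c,b) = z` and `(c,b,b) = -z`. -/
def testOps (F : Type*) [Field F] : BTQOps (Fin 4 → F) where
  comm _ _ := 0
  assoc x y w := ![0, 0, 0, (x 1 * y 2 - x 2 * y 1) * w 1]
  quat x y w t := ![0, 0, x 0 * y 0 * (w 1 * t 0 - w 0 * t 1), 0]

section TestOps

variable (F : Type*) [Field F]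

theorem testOps_isMultilinear : (testOps F).IsMultilinear F := by
  constructor <;> intros <;> constructor <;> intros <;> ext i <;> fin_cases i <;>
    simp [testOps] <;> ring

/-- The quaternary operation is alternating in its last two arguments, so the terms of the sum over
all permutations cancel in pairs. -/
theorem testOps_symmQuat [CharZero F] (x : Fin 4 → Fin 4 → F) : (testOps F).symmQuat x = 0 := by
  have skew : ∀ x y w t, (testOps F).quat x y w t = -(testOps F).quat x y t w := by
    intro x y w t
    ext i
    fin_cases i <;> simp [testOps]
    ring
  rw [← self_eq_neg]
  conv_lhs => rw [BTQOps.symmQuat,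
    ← Equiv.sum_comp (Equiv.mulRight (Equiv.swap (2 : Fin 4) 3))]
  simp only [BTQOps.symmQuat, ← Finset.sum_neg_distrib, Equiv.coe_mulRight, Equiv.Perm.mul_apply,
    Equiv.swap_apply_left, Equiv.swap_apply_right,
    Equiv.swap_apply_of_ne_of_ne (show (0 : Fin 4) ≠ 2 by decide) (show (0 : Fin 4) ≠ 3 by decide),
    Equiv.swap_apply_of_ne_of_ne (show (1 : Fin 4) ≠ 2 by decide) (show (1 : Fin 4) ≠ 3 by decide)]
  exact Finset.sum_congr rfl fun π _ => skew _ _ _ _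

theorem testOps_eval_eq_zero [CharZero F] (p : BTQPoly F (Fin 4))
    (hp : p ∈ insert (specialIdentity₅ F) (btqIdentities F)) (w : Fin 4 → Fin 4 → F) :
    BTQPoly.eval (testOps F) w p = 0 := by
  refine BTQPoly.eval_btqIdentities (testOps_isMultilinear F) ?_ ?_ ?_ ?_ ?_ ?_
    (testOps_symmQuat F) ?_ p hp w
  · intros
    simp [BTQOps.anticomm, testOps]
  · intros
    ext i
    fin_cases i <;> simp [BTQOps.symmAssoc, testOps]
    ring
  · intros
    ext i
    fin_cases i <;> simp [BTQOps.jacobiAssoc, testOps]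
    ring
  · intros
    ext i
    fin_cases i <;> simp [BTQOps.quatSkew, testOps]
    ring
  · intros
    ext i
    fin_cases i <;> simp [BTQOps.quatAlt, testOps]
    ring
  · intros
    ext i
    fin_cases i <;> simp [BTQOps.akivis, testOps]
  · intros
    simp [BTQOps.special₅, testOps]

theorem testOps_special₆ :
    (testOps F).special₆ ![1, 0, 0, 0] ![0, 1, 0, 0] = ![0, 0, 0, 384] := by
  simp [BTQOps.special₆, BTQOps.sixAux, BTQOps.jordanAssoc, BTQOps.derivDefect,
    BTQOps.jordanQuat, BTQOps.jordanQuatSymm, testOps]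
  norm_num

end TestOps

theorem theorem5p3 (F : Type u) [Field F] [CharZero F] :
    ∃ f : BTQPoly F (Fin 2),
      (∀ m ∈ f.support, m.degreeIn 0 = 3 ∧ m.degreeIn 1 = 3) ∧
      (∀ (A : Type (max u v)) [NonUnitalNonAssocRing A] [Module F A]
        [IsScalarTower F A A] [SMulCommClass F A A], IsPowerAssociative F A →
        ∀ x : Fin 2 → A, BTQPoly.eval (primitiveOps A) x f = 0) ∧
      ¬ BTQPoly.IsConsequence (insert (specialIdentity₅ F) (btqIdentities F)) f := by
  refine ⟨(BTQPoly.freeOps F (Fin 2)).special₆ (BTQPoly.var F 0) (BTQPoly.var F 1), ?_, ?_, ?_⟩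
  · intro m hm
    exact Prod.ext_iff.1 (BTQPoly.special₆_mem_homogeneous
      (BTQPoly.single_mem_homogeneous rfl) (BTQPoly.single_mem_homogeneous rfl) hm)
  · intro A _ _ _ _ hA x
    rw [BTQPoly.eval_special₆ x (primitiveOps_isMultilinear F A)]
    exact hA.special₆_eq_zero _ _
  · intro hf
    have h := hf.eval_eq_zero (testOps_isMultilinear F) (testOps_eval_eq_zero F)
      ![![1, 0, 0, 0], ![0, 1, 0, 0]]
    rw [BTQPoly.eval_special₆ _ (testOps_isMultilinear F), BTQPoly.eval_var, BTQPoly.eval_var] at h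
    have h' := (testOps_special₆ F).symm.trans h
    have := congrFun h' 3
    simp at this
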